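/- Let $X_1, X_2, \dots$ be i.i.d. random vectors in $\mathbb{R}^2$ with the standard Gaussian distribution $\mathcal{N}(0, I_2)$. For a real sequence $(\gamma(N))_{N\ge 1}$, let $P = P^{(N)}$ be the random symmetric $N\times N$ matrix with entries $P_{ij} = e^{-\gamma(N)\|X_i - X_j\|^2}$ for $i \ne j$ (with $\|\cdot\|$ the Euclidean norm) and $P_{ii} = 0$, and let $\mu_1(P)$ be its largest eigenvalue. Then for every $\gamma_0 \ge 0$ there exists a constant $C_1(\gamma_0) > 0$, depending only on $\gamma_0$, such that for every sequence $\gamma(N)$ with $\lim_{N\to\infty}\gamma(N) = \gamma_0$, $$\frac{\mu_1(P)}{N\, C_1(\gamma_0)} \longrightarrow 1 \quad\text{almost surely, as } N \to \infty.$$ -/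

import Mathlib

open MeasureTheory ProbabilityTheory Filter Topology

/-- The matrix `P` of the Gaussian kernel `exp (-γ ‖x - y‖²)` at the points `x₁, …, x_N` of the
Euclidean plane: `P i j = exp (-γ ‖x i - x j‖²)` for `i ≠ j`, and `P i i = 0`. -/
noncomputable def kernelMatrix (γ : ℝ) {N : ℕ} (x : Fin N → EuclideanSpace ℝ (Fin 2)) :
    Matrix (Fin N) (Fin N) ℝ :=
  Matrix.of fun i j => if i = j then 0 else Real.exp (-γ * ‖x i - x j‖ ^ 2)

/-- `P` is a real symmetric matrix, so its eigenvalues are real. -/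
theorem kernelMatrix_isHermitian (γ : ℝ) {N : ℕ} (x : Fin N → EuclideanSpace ℝ (Fin 2)) :
    (kernelMatrix γ x).IsHermitian := by
  ext i j
  simp [kernelMatrix, eq_comm, norm_sub_rev (x j) (x i)]

/-- The largest eigenvalue `μ₁(P)`: the maximum of the `N` eigenvalues of `P`
(the value is irrelevant for `N = 0`). -/
noncomputable def largestEigenvalue (γ : ℝ) {N : ℕ} (x : Fin N → EuclideanSpace ℝ (Fin 2)) : ℝ :=
  ⨆ i : Fin N, (kernelMatrix_isHermitian γ x).eigenvalues i

/-! For `γ₀ ≥ 0` the kernel is an inner product of unit feature vectors in a Hilbert space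
(`inner_gaussianFeature`). Its Gram matrix, with diagonal 1, is T*T for the synthesis operator T,
and T T* is the sum of the rank-one operators of the features (`norm_sum_rankOne`). The strong law
in the Banach space of operators makes the norm of this sum, divided by N, converge to the norm of
the covariance operator, which is the constant.

Replacing `γ₀` by `γ N` and the diagonal by 0 changes the quadratic form by at most 1 + o(1)·N times
‖v‖² (`abs_largestEigenvalue_sub_le`): the change of kernel is dominated by a product of weights,
whose squares have finite mean by Fernique's theorem. -/

/-- The synthesis operator `v ↦ ∑ i, v i • f i` of a finite family of vectors. -/
noncomputable def synthesis {ι H : Type*} [Fintype ι] [NormedAddCommGroup H]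
    [InnerProductSpace ℝ H] (f : ι → H) : EuclideanSpace ℝ ι →L[ℝ] H :=
  ∑ i, (EuclideanSpace.proj i : EuclideanSpace ℝ ι →L[ℝ] ℝ).smulRight (f i)

section Synthesis

variable {ι H : Type*} [Fintype ι] [NormedAddCommGroup H] [InnerProductSpace ℝ H]

theorem synthesis_apply (f : ι → H) (v : EuclideanSpace ℝ ι) :
    synthesis f v = ∑ i, v i • f i := by
  simp [synthesis]

theorem norm_synthesis_apply_sq (f : ι → H) (v : EuclideanSpace ℝ ι) :
    ‖synthesis f v‖ ^ 2 = ∑ i, ∑ j, v i * v j * inner ℝ (f i) (f j) := by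
  rw [← real_inner_self_eq_norm_sq, synthesis_apply, sum_inner]
  refine Finset.sum_congr rfl fun i _ => ?_
  rw [inner_sum]
  refine Finset.sum_congr rfl fun j _ => ?_
  rw [real_inner_smul_left, real_inner_smul_right, mul_assoc]

variable [CompleteSpace H]

theorem adjoint_synthesis_apply (f : ι → H) (u : H) (i : ι) :
    (ContinuousLinearMap.adjoint (synthesis f) u) i = inner ℝ (f i) u := by
  classical
  have h := ContinuousLinearMap.adjoint_inner_right (synthesis f)
    (EuclideanSpace.single i (1 : ℝ)) u
  rw [EuclideanSpace.inner_single_left] at h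
  simpa [synthesis_apply] using h

/-- The Gram matrix and the (unnormalized) covariance operator have the same norm. -/
theorem norm_sum_rankOne (f : ι → H) :
    ‖∑ i, InnerProductSpace.rankOne ℝ (f i) (f i)‖ = ‖synthesis f‖ ^ 2 := by
  -- The double adjoint puts T T* in the form S*S with S = T*, ready for the C*-identity.
  have h : ∑ i, InnerProductSpace.rankOne ℝ (f i) (f i)
      = ContinuousLinearMap.adjoint (ContinuousLinearMap.adjoint (synthesis f)) ∘L
        ContinuousLinearMap.adjoint (synthesis f) := by
    ext u
    simp [synthesis_apply, adjoint_synthesis_apply]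
  rw [h, ContinuousLinearMap.norm_adjoint_comp_self, LinearIsometryEquiv.norm_map, sq]

end Synthesis

/-! ### Feature map and covariance operator -/

section FeatureMap

variable {E : Type*} [NormedAddCommGroup E] [InnerProductSpace ℝ E] [FiniteDimensional ℝ E]
  [MeasurableSpace E] [BorelSpace E]

theorem memLp_cexp_inner (x : E) :
    MemLp (fun z : E => Complex.exp ((inner ℝ z x : ℝ) * Complex.I)) 2 (stdGaussian E) := by
  refine MemLp.of_bound (Continuous.aestronglyMeasurable (by fun_prop)) 1 (ae_of_all _ fun z => ?_)
  rw [Complex.norm_exp_ofReal_mul_I]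

/-- A feature map of the Gaussian kernel `exp (-γ ‖x - y‖²)`: the characters of the space, seen
in `L²` of the standard Gaussian measure. -/
noncomputable def gaussianFeature (γ : ℝ) (x : E) : Lp ℂ 2 (stdGaussian E) :=
  (memLp_cexp_inner (√(2 * γ) • x)).toLp _

/-- The kernel is the characteristic function of the standard Gaussian at √(2γ)(y - x); the real
inner product on complex L² takes its real part. -/
theorem inner_gaussianFeature {γ : ℝ} (hγ : 0 ≤ γ) (x y : E) :
    inner ℝ (gaussianFeature γ x) (gaussianFeature γ y) = Real.exp (-γ * ‖x - y‖ ^ 2) := by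
  have h1 : inner ℝ (gaussianFeature γ x) (gaussianFeature γ y)
      = ∫ z : E, (Complex.exp ((inner ℝ z (√(2 * γ) • (y - x)) : ℝ) * Complex.I)).re
          ∂(stdGaussian E) := by
    rw [L2.inner_def]
    refine integral_congr_ae ?_
    filter_upwards [(memLp_cexp_inner (√(2 * γ) • x)).coeFn_toLp,
      (memLp_cexp_inner (√(2 * γ) • y)).coeFn_toLp] with z hx hy
    rw [gaussianFeature, gaussianFeature, hx, hy, Complex.inner, ← Complex.exp_conj,
      ← Complex.exp_add]
    congr 2
    simp only [map_mul, Complex.conj_ofReal, Complex.conj_I, inner_sub_right, smul_sub]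
    push_cast
    ring
  have h2 : ∫ z : E, (Complex.exp ((inner ℝ z (√(2 * γ) • (y - x)) : ℝ) * Complex.I)).re
          ∂(stdGaussian E) = (charFun (stdGaussian E) (√(2 * γ) • (y - x))).re := by
    rw [charFun_apply]
    exact integral_re ((memLp_cexp_inner _).integrable (by norm_num))
  rw [h1, h2, charFun_stdGaussian]
  have h3 : (‖√(2 * γ) • (y - x)‖ : ℝ) ^ 2 = 2 * γ * ‖x - y‖ ^ 2 := by
    rw [norm_smul, mul_pow, Real.norm_eq_abs, sq_abs, Real.sq_sqrt (by positivity),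
      norm_sub_rev]
  have h4 : (-((‖√(2 * γ) • (y - x)‖ : ℝ) : ℂ) ^ 2 / 2) = ((-γ * ‖x - y‖ ^ 2 : ℝ) : ℂ) := by
    rw [← Complex.ofReal_pow, h3]
    push_cast
    ring
  rw [h4, Complex.exp_ofReal_re]

theorem norm_gaussianFeature {γ : ℝ} (hγ : 0 ≤ γ) (x : E) : ‖gaussianFeature γ x‖ = 1 := by
  have h := real_inner_self_eq_norm_sq (gaussianFeature γ x)
  rw [inner_gaussianFeature hγ] at h
  rw [← pow_left_inj₀ (norm_nonneg _) zero_le_one two_ne_zero, ← h]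
  simp

theorem continuous_gaussianFeature {γ : ℝ} (hγ : 0 ≤ γ) :
    Continuous (gaussianFeature γ : E → Lp ℂ 2 (stdGaussian E)) := by
  rw [continuous_iff_continuousAt]
  intro x
  rw [ContinuousAt, tendsto_iff_norm_sub_tendsto_zero]
  have h (y : E) : ‖gaussianFeature γ y - gaussianFeature γ x‖
      = √(2 - 2 * Real.exp (-γ * ‖y - x‖ ^ 2)) := by
    rw [← Real.sqrt_sq (norm_nonneg (gaussianFeature γ y - _)), norm_sub_sq_real,
      inner_gaussianFeature hγ, norm_gaussianFeature hγ, norm_gaussianFeature hγ]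
    ring_nf
  simp_rw [h]
  have : Continuous fun y : E => √(2 - 2 * Real.exp (-γ * ‖y - x‖ ^ 2)) := by fun_prop
  simpa using this.tendsto x

/-- The covariance operator of the Gaussian features of a standard Gaussian vector. -/
noncomputable def featureCovariance (E : Type*) [NormedAddCommGroup E] [InnerProductSpace ℝ E]
    [FiniteDimensional ℝ E] [MeasurableSpace E] [BorelSpace E] (γ : ℝ) :
    Lp ℂ 2 (stdGaussian E) →L[ℝ] Lp ℂ 2 (stdGaussian E) :=
  ∫ x : E, InnerProductSpace.rankOne ℝ (gaussianFeature γ x) (gaussianFeature γ x) ∂(stdGaussian E)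

theorem continuous_rankOne_gaussianFeature {γ : ℝ} (hγ : 0 ≤ γ) :
    Continuous fun x : E =>
      InnerProductSpace.rankOne ℝ (gaussianFeature γ x) (gaussianFeature γ x) := by
  simp_rw [InnerProductSpace.rankOne_def]
  have := continuous_gaussianFeature (E := E) hγ
  have h : Continuous fun x : E => innerSL ℝ (gaussianFeature γ x) :=
    (innerSL ℝ).continuous.comp this
  exact ((ContinuousLinearMap.smulRightL ℝ _ _).continuous.comp h).clm_apply this

theorem integrable_rankOne_gaussianFeature {γ : ℝ} (hγ : 0 ≤ γ) :
    Integrable (fun x : E =>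
      InnerProductSpace.rankOne ℝ (gaussianFeature γ x) (gaussianFeature γ x))
      (stdGaussian E) := by
  refine Integrable.of_bound (continuous_rankOne_gaussianFeature hγ).aestronglyMeasurable 1
    (ae_of_all _ fun x => ?_)
  simp [norm_gaussianFeature hγ]

/-- Tested on the feature of 0, the quadratic form is the mean of a positive function. -/
theorem featureCovariance_ne_zero {γ : ℝ} (hγ : 0 ≤ γ) : featureCovariance E γ ≠ 0 := by
  intro h0
  set u : Lp ℂ 2 (stdGaussian E) := gaussianFeature γ 0
  have hint := integrable_rankOne_gaussianFeature (E := E) hγ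
  have h1 : inner ℝ u (featureCovariance E γ u)
      = ∫ x : E, Real.exp (-γ * ‖x‖ ^ 2) ^ 2 ∂(stdGaussian E) := by
    rw [featureCovariance, ContinuousLinearMap.integral_apply hint,
      ← integral_inner (hint.apply_continuousLinearMap u)]
    refine integral_congr_ae (ae_of_all _ fun x => ?_)
    simp only [InnerProductSpace.inner_right_rankOne_apply, u, inner_gaussianFeature hγ]
    simp [sq]
  have h2 : 0 < ∫ x : E, Real.exp (-γ * ‖x‖ ^ 2) ^ 2 ∂(stdGaussian E) := by
    have hi : Integrable (fun x : E => Real.exp (-γ * ‖x‖ ^ 2) ^ 2) (stdGaussian E) := by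
      refine Integrable.of_bound (Continuous.aestronglyMeasurable (by fun_prop)) 1
        (ae_of_all _ fun x => ?_)
      have : Real.exp (-γ * ‖x‖ ^ 2) ≤ 1 := Real.exp_le_one_iff.2 (by nlinarith [sq_nonneg ‖x‖])
      rw [Real.norm_of_nonneg (by positivity)]
      exact pow_le_one₀ (by positivity) this
    rw [integral_pos_iff_support_of_nonneg (fun x => by positivity) hi]
    have : Function.support (fun x : E => Real.exp (-γ * ‖x‖ ^ 2) ^ 2) = Set.univ := by
      ext x
      simp
    rw [this, measure_univ]
    exact zero_lt_one
  rw [← h1, h0] at h2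
  simp at h2

end FeatureMap

/-! ### Strong law for operators -/

section StrongLaw

variable {E : Type*} [NormedAddCommGroup E] [InnerProductSpace ℝ E] [FiniteDimensional ℝ E]
  [MeasurableSpace E] [BorelSpace E] {Ω : Type*} [MeasurableSpace Ω] {μ : Measure Ω}

/-- The strong law of large numbers for a continuous function of i.i.d. random vectors. -/
theorem strong_law_comp_of_hasLaw {F : Type*} [NormedAddCommGroup F] [NormedSpace ℝ F]
    [CompleteSpace F] {ν : Measure E} {X : ℕ → Ω → E} (hX : ∀ i, HasLaw (X i) ν μ)
    (hind : iIndepFun X μ) {g : E → F} (hg : Continuous g) (hint : Integrable g ν) :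
    ∀ᵐ ω ∂μ, Tendsto (fun n : ℕ => (n : ℝ)⁻¹ • ∑ i : Fin n, g (X i ω)) atTop
      (𝓝 (∫ x, g x ∂ν)) := by
  borelize F
  have h := strong_law_ae (μ := μ) (fun i ω => g (X i ω)) ?_ ?_ ?_
  · filter_upwards [h] with ω hω
    simp_rw [Fin.sum_univ_eq_sum_range (fun i => g (X i ω))]
    rwa [← (hX 0).integral_comp hg.aestronglyMeasurable]
  · rw [← (hX 0).map_eq] at hint
    exact hint.comp_aemeasurable (hX 0).aemeasurable
  · intro i j hij
    exact (hind.indepFun hij).comp hg.measurable hg.measurable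
  · intro i
    exact ((hX i).identDistrib (hX 0)).comp hg.measurable

theorem tendsto_norm_sum_rankOne_gaussianFeature {γ : ℝ} (hγ : 0 ≤ γ)
    {X : ℕ → Ω → E} (hX : ∀ i, HasLaw (X i) (stdGaussian E) μ) (hind : iIndepFun X μ) :
    ∀ᵐ ω ∂μ, Tendsto (fun n : ℕ => (n : ℝ)⁻¹ * ‖∑ i : Fin n, InnerProductSpace.rankOne ℝ
      (gaussianFeature γ (X i ω)) (gaussianFeature γ (X i ω))‖) atTop
      (𝓝 ‖featureCovariance E γ‖) := by
  filter_upwards [strong_law_comp_of_hasLaw hX hind (continuous_rankOne_gaussianFeature hγ)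
    (integrable_rankOne_gaussianFeature hγ)] with ω hω
  rw [featureCovariance]
  refine hω.norm.congr fun n => ?_
  rw [norm_smul, norm_inv, Real.norm_natCast]

end StrongLaw

/-! ### Largest eigenvalue and quadratic form -/

section Eigenvalue

theorem quadraticForm_eq_sum_eigenvalues {n : Type*} [Fintype n] [DecidableEq n]
    {A : Matrix n n ℝ} (hA : A.IsHermitian) (v : EuclideanSpace ℝ n) :
    ∑ k, ∑ l, v k * v l * A k l
      = ∑ i, hA.eigenvalues i * inner ℝ (hA.eigenvectorBasis i) v ^ 2 := by
  have hb (i : n) : A.toEuclideanLin (hA.eigenvectorBasis i)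
      = hA.eigenvalues i • hA.eigenvectorBasis i := by
    rw [Matrix.toLpLin_apply, hA.mulVec_eigenvectorBasis]
    rfl
  calc ∑ k, ∑ l, v k * v l * A k l = inner ℝ v (A.toEuclideanLin v) := by
        simp only [PiLp.inner_apply, Matrix.toLpLin_apply, Matrix.mulVec, dotProduct,
          RCLike.inner_apply, conj_trivial, Finset.sum_mul]
        exact Finset.sum_congr rfl fun k _ => Finset.sum_congr rfl fun l _ => by ring
    _ = ∑ i, inner ℝ v (hA.eigenvectorBasis i)
          * inner ℝ (hA.eigenvectorBasis i) (A.toEuclideanLin v) :=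
        (hA.eigenvectorBasis.sum_inner_mul_inner _ _).symm
    _ = _ := by
        refine Finset.sum_congr rfl fun i _ => ?_
        rw [← (Matrix.isSymmetric_toEuclideanLin_iff.mpr hA) _ v, hb, real_inner_smul_left,
          real_inner_comm]
        ring

theorem quadraticForm_eigenvectorBasis {n : Type*} [Fintype n] [DecidableEq n]
    {A : Matrix n n ℝ} (hA : A.IsHermitian) (i : n) :
    ∑ k, ∑ l, hA.eigenvectorBasis i k * hA.eigenvectorBasis i l * A k l = hA.eigenvalues i := by
  rw [quadraticForm_eq_sum_eigenvalues hA, Finset.sum_eq_single i]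
  · simp
  · intro j _ hj
    simp [orthonormal_iff_ite.1 hA.eigenvectorBasis.orthonormal, hj]
  · simp

theorem quadraticForm_le {n : Type*} [Fintype n] [DecidableEq n]
    {A : Matrix n n ℝ} (hA : A.IsHermitian) {c : ℝ} (hc : ∀ i, hA.eigenvalues i ≤ c)
    (v : EuclideanSpace ℝ n) :
    ∑ k, ∑ l, v k * v l * A k l ≤ c * ‖v‖ ^ 2 := by
  rw [quadraticForm_eq_sum_eigenvalues hA, ← hA.eigenvectorBasis.sum_sq_inner_right v,
    Finset.mul_sum]
  gcongr with i
  exact hc i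

/-- If the quadratic form of `A` is within `δ` of `v ↦ ‖T v‖²`, then the largest eigenvalue of `A`
is within `δ` of `‖T‖²`. -/
theorem abs_iSup_eigenvalues_sub_norm_sq_le {n H : Type*} [Fintype n] [DecidableEq n] [Nonempty n]
    [NormedAddCommGroup H] [InnerProductSpace ℝ H]
    {A : Matrix n n ℝ} (hA : A.IsHermitian) (T : EuclideanSpace ℝ n →L[ℝ] H) {δ : ℝ}
    (h : ∀ v : EuclideanSpace ℝ n,
      |∑ k, ∑ l, v k * v l * A k l - ‖T v‖ ^ 2| ≤ δ * ‖v‖ ^ 2) :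
    |(⨆ i, hA.eigenvalues i) - ‖T‖ ^ 2| ≤ δ := by
  have hle (i : n) : hA.eigenvalues i ≤ ⨆ i, hA.eigenvalues i :=
    le_ciSup (Set.finite_range _).bddAbove i
  rw [abs_le]
  constructor
  · set s := (⨆ i, hA.eigenvalues i) + δ with hs
    have hv (v : EuclideanSpace ℝ n) : ‖T v‖ ^ 2 ≤ s * ‖v‖ ^ 2 := by
      have h1 := (abs_le.1 (h v)).1
      have h2 := quadraticForm_le hA hle v
      rw [hs, add_mul]
      linarith
    -- Any unit vector would do here; one exists because the index type is nonempty.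
    have hs0 : 0 ≤ s := by
      have h1 := hv (hA.eigenvectorBasis (Classical.arbitrary n))
      simp only [OrthonormalBasis.norm_eq_one, one_pow, mul_one] at h1
      exact (sq_nonneg _).trans h1
    have hT : ‖T‖ ≤ √s := by
      refine T.opNorm_le_bound (Real.sqrt_nonneg _) fun v => ?_
      refine le_of_sq_le_sq ?_ (by positivity)
      rw [mul_pow, Real.sq_sqrt hs0]
      exact hv v
    have : ‖T‖ ^ 2 ≤ s := by
      rw [← Real.sq_sqrt hs0]
      gcongr
    linarith
  · suffices (⨆ i, hA.eigenvalues i) ≤ ‖T‖ ^ 2 + δ by linarith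
    refine ciSup_le fun i => ?_
    have h1 := (abs_le.1 (h (hA.eigenvectorBasis i))).2
    rw [quadraticForm_eigenvectorBasis, OrthonormalBasis.norm_eq_one] at h1
    have h2 : ‖T (hA.eigenvectorBasis i)‖ ≤ ‖T‖ := by
      simpa using T.le_opNorm (hA.eigenvectorBasis i)
    have h3 : ‖T (hA.eigenvectorBasis i)‖ ^ 2 ≤ ‖T‖ ^ 2 := by gcongr
    linarith

end Eigenvalue

/-! ### Perturbation of the kernel and the limit -/

theorem abs_exp_neg_mul_sub_le {a b ε t : ℝ} (ha : -ε ≤ a) (hb : -ε ≤ b) (ht : 0 ≤ t) :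
    |Real.exp (-a * t) - Real.exp (-b * t)| ≤ |a - b| * (t * Real.exp (ε * t)) := by
  wlog hab : a ≤ b generalizing a b
  · rw [abs_sub_comm, abs_sub_comm a]
    exact this hb ha (le_of_not_ge hab)
  have h1 : Real.exp (-b * t) = Real.exp (-a * t) * Real.exp (-((b - a) * t)) := by
    rw [← Real.exp_add]; ring_nf
  have h2 := Real.add_one_le_exp (-((b - a) * t))
  have h3 : Real.exp (-a * t) ≤ Real.exp (ε * t) := Real.exp_le_exp.2 (by nlinarith)
  have h4 : Real.exp (-b * t) ≤ Real.exp (-a * t) := Real.exp_le_exp.2 (by nlinarith)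
  rw [abs_of_nonneg (by linarith), abs_of_nonpos (by linarith), h1]
  have h5 : 0 ≤ (b - a) * t := mul_nonneg (by linarith) ht
  nlinarith [Real.exp_pos (-a * t), mul_le_mul_of_nonneg_left h3 h5]

/-- The Gaussian kernel is Lipschitz in its parameter, with a constant that is a product of
weights in the two points. -/
theorem abs_gaussianKernel_sub_le {E : Type*} [NormedAddCommGroup E] [InnerProductSpace ℝ E]
    {a b ε : ℝ} (hε : 0 < ε) (ha : -ε ≤ a) (hb : -ε ≤ b) (x y : E) :
    |Real.exp (-a * ‖x - y‖ ^ 2) - Real.exp (-b * ‖x - y‖ ^ 2)|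
      ≤ |a - b| / ε * (Real.exp (4 * ε * ‖x‖ ^ 2) * Real.exp (4 * ε * ‖y‖ ^ 2)) := by
  set t := ‖x - y‖ ^ 2 with ht
  have ht0 : 0 ≤ t := by positivity
  have ht1 : t ≤ 2 * ‖x‖ ^ 2 + 2 * ‖y‖ ^ 2 := by
    have := parallelogram_law_with_norm ℝ x y
    nlinarith [sq_nonneg ‖x + y‖]
  refine (abs_exp_neg_mul_sub_le ha hb ht0).trans ?_
  rw [div_mul_eq_mul_div, mul_div_assoc]
  gcongr
  -- The factor t is absorbed through εt ≤ exp(εt), at the price of 1/ε and a doubled exponent.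
  rw [le_div_iff₀ hε, ← Real.exp_add]
  calc t * Real.exp (ε * t) * ε = (ε * t) * Real.exp (ε * t) := by ring
    _ ≤ Real.exp (ε * t) * Real.exp (ε * t) := by
        gcongr
        linarith [Real.add_one_le_exp (ε * t)]
    _ = Real.exp (2 * ε * t) := by rw [← Real.exp_add]; ring_nf
    _ ≤ _ := Real.exp_le_exp.2 (by nlinarith)

/-- Cauchy–Schwarz applied to the rank-one weight matrix; the identity term is for the diagonal,
where the matrix has 0 and the Gram matrix 1. -/
theorem abs_quadraticForm_le_of_abs_le {n : Type*} [Fintype n] [DecidableEq n]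
    {D : n → n → ℝ} {c : ℝ} (hc : 0 ≤ c) {w : n → ℝ}
    (hD : ∀ i j, |D i j| ≤ (if i = j then 1 else 0) + c * (w i * w j))
    (v : EuclideanSpace ℝ n) :
    |∑ i, ∑ j, v i * v j * D i j| ≤ (1 + c * ∑ i, w i ^ 2) * ‖v‖ ^ 2 := by
  have hcs := Finset.sum_mul_sq_le_sq_mul_sq Finset.univ (fun i => |v i|) w
  calc |∑ i, ∑ j, v i * v j * D i j|
      ≤ ∑ i, ∑ j, |v i| * |v j| * ((if i = j then 1 else 0) + c * (w i * w j)) := by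
        refine (Finset.abs_sum_le_sum_abs _ _).trans (Finset.sum_le_sum fun i _ => ?_)
        refine (Finset.abs_sum_le_sum_abs _ _).trans (Finset.sum_le_sum fun j _ => ?_)
        rw [abs_mul, abs_mul]
        exact mul_le_mul_of_nonneg_left (hD i j) (by positivity)
    _ = ∑ i, |v i| ^ 2 + c * (∑ i, |v i| * w i) ^ 2 := by
        rw [sq (∑ i, |v i| * w i), Finset.sum_mul_sum, Finset.mul_sum, ← Finset.sum_add_distrib]
        refine Finset.sum_congr rfl fun i _ => ?_
        simp_rw [mul_add, Finset.sum_add_distrib, Finset.mul_sum]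
        congr 1
        · simp [sq]
        · exact Finset.sum_congr rfl fun j _ => by ring
    _ ≤ ∑ i, |v i| ^ 2 + c * ((∑ i, |v i| ^ 2) * ∑ i, w i ^ 2) := by gcongr
    _ = _ := by
        simp_rw [EuclideanSpace.norm_sq_eq, Real.norm_eq_abs]
        ring

theorem abs_largestEigenvalue_sub_le {γ γ₀ ε : ℝ} (hε : 0 < ε) (hγ : -ε ≤ γ) (hγ₀ : 0 ≤ γ₀)
    {N : ℕ} [NeZero N] (x : Fin N → EuclideanSpace ℝ (Fin 2)) :
    |largestEigenvalue γ x - ‖∑ i, InnerProductSpace.rankOne ℝ (gaussianFeature γ₀ (x i))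
      (gaussianFeature γ₀ (x i))‖|
      ≤ 1 + |γ - γ₀| / ε * ∑ i, Real.exp (8 * ε * ‖x i‖ ^ 2) := by
  rw [norm_sum_rankOne]
  refine abs_iSup_eigenvalues_sub_norm_sq_le _ _ fun v => ?_
  have h := abs_quadraticForm_le_of_abs_le
    (D := fun i j => kernelMatrix γ x i j - Real.exp (-γ₀ * ‖x i - x j‖ ^ 2))
    (c := |γ - γ₀| / ε) (by positivity) (w := fun i => Real.exp (4 * ε * ‖x i‖ ^ 2)) ?_ v
  · have hw (i : Fin N) :
        Real.exp (4 * ε * ‖x i‖ ^ 2) ^ 2 = Real.exp (8 * ε * ‖x i‖ ^ 2) := by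
      rw [← Real.exp_nat_mul]; ring_nf
    simp_rw [hw, mul_sub, Finset.sum_sub_distrib] at h
    simpa only [norm_synthesis_apply_sq, inner_gaussianFeature hγ₀] using h
  · intro i j
    rcases eq_or_ne i j with rfl | hij
    · simp only [kernelMatrix, Matrix.of_apply, if_true, sub_self, norm_zero]
      norm_num
      positivity
    · simp only [kernelMatrix, Matrix.of_apply, if_neg hij, zero_add]
      exact abs_gaussianKernel_sub_le hε hγ (by linarith) _ _

/-- The largest eigenvalue of the random kernel matrix, divided by the number of points, converges
almost surely to the norm of the covariance operator of the features. -/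
theorem tendsto_largestEigenvalue_div {γ₀ : ℝ} (hγ₀ : 0 ≤ γ₀) {γ : ℕ → ℝ}
    (hγ : Tendsto γ atTop (𝓝 γ₀)) {Ω : Type*} [MeasurableSpace Ω] {μ : Measure Ω}
    {X : ℕ → Ω → EuclideanSpace ℝ (Fin 2)}
    (hX : ∀ i, HasLaw (X i) (stdGaussian (EuclideanSpace ℝ (Fin 2))) μ) (hind : iIndepFun X μ) :
    ∀ᵐ ω ∂μ, Tendsto
      (fun N : ℕ => largestEigenvalue (γ N) (fun i : Fin N => X i ω) / N) atTop
      (𝓝 ‖featureCovariance (EuclideanSpace ℝ (Fin 2)) γ₀‖) := by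
  obtain ⟨C, hC, hCint⟩ := IsGaussian.exists_integrable_exp_sq
    (stdGaussian (EuclideanSpace ℝ (Fin 2)))
  -- The weights exp(4ε‖x‖²) enter squared, so 8ε must be Fernique's exponent `C`.
  set ε := C / 8 with hεC
  have hε : 0 < ε := by positivity
  have hC8 : C = 8 * ε := by rw [hεC]; ring
  rw [hC8] at hCint
  filter_upwards [strong_law_comp_of_hasLaw hX hind (by fun_prop) hCint,
    tendsto_norm_sum_rankOne_gaussianFeature hγ₀ hX hind] with ω hS hT
  have herr : Tendsto (fun N : ℕ => (N : ℝ)⁻¹ + |γ N - γ₀| / ε *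
      ((N : ℝ)⁻¹ • ∑ i : Fin N, Real.exp (8 * ε * ‖X i ω‖ ^ 2))) atTop (𝓝 0) := by
    have h1 : Tendsto (fun N : ℕ => (N : ℝ)⁻¹) atTop (𝓝 0) := tendsto_inv_atTop_nhds_zero_nat
    have h2 : Tendsto (fun N => |γ N - γ₀| / ε) atTop (𝓝 0) := by
      simpa using ((hγ.sub_const γ₀).abs.div_const ε)
    simpa using h1.add (h2.mul hS)
  refine (tendsto_iff_of_dist ?_).1 hT
  refine squeeze_zero' (Eventually.of_forall fun _ => dist_nonneg) ?_ herr
  -- When `γ₀ = 0`, `γ N` may be negative; only the lower bound -ε is needed.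
  filter_upwards [eventually_gt_atTop 0, hγ.eventually_const_le
    (show -ε < γ₀ by linarith)] with N hN hγN
  have : NeZero N := ⟨hN.ne'⟩
  have hN' : (0 : ℝ) < N := by exact_mod_cast hN
  have h := abs_largestEigenvalue_sub_le hε hγN hγ₀ (fun i : Fin N => X i ω)
  generalize ‖∑ i : Fin N, InnerProductSpace.rankOne ℝ (gaussianFeature γ₀ (X i ω))
    (gaussianFeature γ₀ (X i ω))‖ = a at h ⊢
  generalize largestEigenvalue (γ N) (fun i : Fin N => X i ω) = b at h ⊢
  calc dist ((N : ℝ)⁻¹ * a) (b / N) = (N : ℝ)⁻¹ * |b - a| := by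
        rw [dist_comm, Real.dist_eq, div_eq_inv_mul, ← mul_sub, abs_mul,
          abs_of_pos (inv_pos.2 hN')]
    _ ≤ (N : ℝ)⁻¹ * (1 + |γ N - γ₀| / ε * ∑ i : Fin N, Real.exp (8 * ε * ‖X i ω‖ ^ 2)) := by
        gcongr
    _ = _ := by
        rw [smul_eq_mul]
        ring

theorem proposition1 :
    ∃ C₁ : ℝ → ℝ, ∀ γ₀ : ℝ, 0 ≤ γ₀ → 0 < C₁ γ₀ ∧
      ∀ γ : ℕ → ℝ, Tendsto γ atTop (𝓝 γ₀) →
      ∀ {Ω : Type*} [MeasurableSpace Ω] (μ : Measure Ω) [IsProbabilityMeasure μ]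
        (X : ℕ → Ω → EuclideanSpace ℝ (Fin 2)),
        (∀ i, HasLaw (X i) (stdGaussian (EuclideanSpace ℝ (Fin 2))) μ) →
        iIndepFun X μ →
        ∀ᵐ ω ∂μ, Tendsto
          (fun N : ℕ => largestEigenvalue (γ N) (fun i : Fin N => X i ω) / (N * C₁ γ₀))
          atTop (𝓝 1) := by
  refine ⟨fun γ₀ => ‖featureCovariance (EuclideanSpace ℝ (Fin 2)) γ₀‖, fun γ₀ hγ₀ => ?_⟩
  have hpos := norm_pos_iff.2 (featureCovariance_ne_zero (E := EuclideanSpace ℝ (Fin 2)) hγ₀)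
  refine ⟨hpos, fun γ hγ Ω _ μ _ X hX hind => ?_⟩
  filter_upwards [tendsto_largestEigenvalue_div hγ₀ hγ hX hind] with ω hω
  have := hω.div_const ‖featureCovariance (EuclideanSpace ℝ (Fin 2)) γ₀‖
  simpa only [div_div, div_self hpos.ne'] using this
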